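/- **Model (static setting).** A single server serves $N$ users in slots $t=1,2,\dots$. In every slot user $n$ has $a_{\max}\in\mathbb N$ potential packets. The vector of indicators telling which of them really arrive is i.i.d. over slots with a given law $\alpha_n$ on $\{0,1\}^{a_{\max}}$, and independent over users. User $n$ has a deadline $\tau_n\ge 1$ (a packet arriving in slot $t$ can be transmitted in slots $t,\dots,t+\tau_n-1$), a prediction window of size $D_n\ge 0$, a weight $\beta_n\ge 0$ and a transmission success probability $\zeta_n\in(0,1]$. There is a resource budget $B\ge 0$. *Predictions.* In slot $t$ the server sees the actual arrivals of slot $t$ and, for every potential packet of user $n$ in slots $t+1,\dots,t+D_n$, a prediction whether it will arrive. The vectors of predictions for one slot are i.i.d. over slots and independent over users. Given the predictions, and independently for all potential packets, a packet predicted to arrive really arrives with probability $p_n$ (the true-positive rate), and a packet predicted not to arrive does arrive with probability $q_n$ (the false-negative rate), where $0\le q_n<p_n\le 1$. The law of the predictions is consistent with the given arrival process, i.e. it induces the law $\alpha_n$ of the actual arrivals. (In particular $a_n=\tilde a_np_n+(a_{\max}-\tilde a_n)q_n$, where $a_n$ and $\tilde a_n$ are the mean numbers of actual and of predicted arrivals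 per slot.) *Service.* In every slot the server decides, for each packet at the source, whether to transmit it; this may be a packet in the system or a packet in the prediction window that is predicted to arrive. There is no limit on the number of transmissions in a slot. Each transmission costs one unit of resource and independently succeeds with probability $\zeta_n$. Packets predicted not to arrive can be served only after they have entered the system; a predicted packet that turns out to be a false alarm disappears in the slot in which it should have arrived, without reward. A policy $\pi$ is randomized and may depend on the whole history. Let $E_n(t)$ be the number of transmissions for user $n$ in slot $t$, and let $X_n(t)$ be the number of packets of user $n$ timely delivered in slot $t$ (a real packet delivered during the prediction window counts in the slot of its arrival). Put $$x_n(\pi)=\liminf_{T\to\infty}\frac1T\,\mathbb E_\pi\sum_{t=1}^T X_n(t),\qquad E_{av}(\pi)=\limsup_{T\to\infty}\frac1T\,\mathbb E_\pi\sum_{t=1}^T\sum_{n=1}^N E_n(t).$$ The optimal weighted timely-throughput is $$\phi^*_I(\boldsymbol p,\boldsymbol q)=\sup\Big\{\sum_{n=1}^N\beta_n x_n(\pi)\;:\;\pi\text{ a policy with }E_{av}(\pi)\le B\Big\}.$$ **Theorem.** Fix $N$, $a_{\max}$, $\alpha_n,\tau_n,D_n,\zeta_n,\beta_n$ ($1\le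 n\le N$) and $B$, and order vectors componentwise. Among the predictions consistent with the arrival process: (i) $\phi^*_I$ is non-increasing in the false-negative vector: if $\boldsymbol q\le\boldsymbol q'$, then $\phi^*_I(\boldsymbol p,\boldsymbol q')\le\phi^*_I(\boldsymbol p,\boldsymbol q)$. (ii) If $\boldsymbol q=\boldsymbol 0$, then $\phi^*_I$ is non-decreasing in the true-positive vector: if $\boldsymbol p\le\boldsymbol p'$, then $\phi^*_I(\boldsymbol p,\boldsymbol 0)\le\phi^*_I(\boldsymbol p',\boldsymbol 0)$. -/

import Mathlib

open scoped ENNReal NNReal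

namespace TimelyThroughput

/-- The joint law of independent random variables with laws `m i`, on finite spaces. -/
noncomputable def indep {ι : Type*} [Fintype ι] [DecidableEq ι] {α : ι → Type*}
    [∀ i, Fintype (α i)] (m : ∀ i, PMF (α i)) : PMF (∀ i, α i) :=
  PMF.ofFintype (fun x => ∏ i, m i (x i)) (by
    have h := Finset.prod_univ_sum (fun i => (Finset.univ : Finset (α i))) (fun i a => m i a)
    rw [Fintype.piFinset_univ] at h
    rw [← h]
    refine Finset.prod_eq_one fun i _ => ?_
    rw [← tsum_fintype (L := .unconditional _)]
    exact (m i).tsum_coe)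

/-- A coin that shows `true` with probability `r`. -/
noncomputable def coin (r : unitInterval) : PMF Bool :=
  PMF.ofFintype (fun b => ENNReal.ofReal (if b then (r : ℝ) else 1 - r)) (by
    have h := r.2
    simp only [Fintype.sum_bool, if_true, Bool.false_eq_true, if_false]
    rw [← ENNReal.ofReal_add h.1 (by linarith [h.2])]
    simp)

/-- The static single-server system with `N` users and at most `A` arrivals per user and slot.
In every slot each user has `A` potential packets; `arrivals n` is the joint law of the indicators
telling which of them really arrive. This vector of indicators is i.i.d. over the slots and
independent over the users; the number of arrivals `A_n(t)` is the number of its `true` entries. -/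
structure StaticSystem (N A : ℕ) where
  /-- deadlines: a packet arriving in slot `t` can be transmitted in slots `t, …, t + τ n - 1` -/
  τ : Fin N → ℕ
  τ_pos : ∀ n, 0 < τ n
  /-- sizes of the prediction windows -/
  D : Fin N → ℕ
  /-- success probability of one transmission -/
  ζ : Fin N → unitInterval
  ζ_pos : ∀ n, 0 < ζ n
  /-- weights of the users -/
  β : Fin N → ℝ≥0
  /-- the budget for the average resource expenditure -/
  B : ℝ≥0
  /-- the law of the actual arrivals of one slot -/
  arrivals : ∀ _ : Fin N, PMF (Fin A → Bool)

variable {N A : ℕ}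

/-- The law of the actual arrivals of a slot given its predictions `b`: independently for each
potential packet, a positive prediction is correct with probability `p`, and a packet that was
predicted not to arrive does arrive with probability `q`. -/
noncomputable def actualGiven (p q : unitInterval) (b : Fin A → Bool) : PMF (Fin A → Bool) :=
  indep fun k => coin (if b k then p else q)

/-- An imperfect prediction of the arrivals of the system `S`, with true-positive rates `p` and
false-negative rates `q`. `predicted n` is the law of the predictions made for one slot (i.i.d. over
slots, independent over users). The arrival process of `S` is given, so the predictions have to be
consistent with it; taking expected numbers, `consistent` gives
`a_n = ã_n p_n + (A - ã_n) q_n` for the rate `ã_n` of the predicted arrivals. -/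
structure Prediction (S : StaticSystem N A) where
  p : Fin N → unitInterval
  q : Fin N → unitInterval
  q_lt_p : ∀ n, q n < p n
  predicted : ∀ _ : Fin N, PMF (Fin A → Bool)
  consistent : ∀ n, (predicted n).bind (actualGiven (p n) (q n)) = S.arrivals n

/-- The status of a potential packet. `none`: there is no packet (if its slot lies in the future: it
is predicted not to arrive). `some r`: there is a packet (if its slot lies in the future: it is
predicted to arrive) with reception status `r`, where `some false` means at the source and
`some true` means received at the destination. -/
abbrev Status := Option Bool

/-- The state of the system: the status of the `k`-th potential packet of user `n` with `j + 1`
slots left until its deadline. The packets with `j + 1 ≤ τ n` have entered the system, those with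
`j + 1 = τ n` in the current slot; those with `j + 1 > τ n` are in the prediction window. -/
abbrev State (S : StaticSystem N A) : Type :=
  ∀ n : Fin N, Fin (S.τ n + S.D n) → Fin A → Status

/-- A scheduling decision: which packets to transmit. It only matters for those at the source. -/
abbrev Action (S : StaticSystem N A) : Type :=
  ∀ n : Fin N, Fin (S.τ n + S.D n) → Fin A → Bool

/-- What happened in one slot: the state, the decision, and the state after the transmissions. -/
structure Record (S : StaticSystem N A) where
  before : State S
  action : Action S
  after : State S

/-- The law of the state after the transmissions of one slot: each transmission of a packet of user
`n` independently succeeds with probability `ζ n`. -/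
noncomputable def transmit (S : StaticSystem N A) (s : State S) (u : Action S) : PMF (State S) :=
  indep fun n => indep fun j => indep fun k =>
    if s n j k = some false ∧ u n j k = true then (coin (S.ζ n)).map some
    else PMF.pure (s n j k)

namespace Prediction

variable {S : StaticSystem N A} (P : Prediction S)

/-- The column of newly predicted packets of user `n`. -/
noncomputable def fresh (n : Fin N) : PMF (Fin A → Status) :=
  (P.predicted n).map fun b k => if b k then some false else none

/-- The actual arrivals of a slot replace its predictions: a predicted packet is real with
probability `p n` (and then keeps its reception status), otherwise it was a false alarm and
disappears; an unpredicted packet shows up at the source with probability `q n`. -/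
noncomputable def reveal (n : Fin N) (col : Fin A → Status) : PMF (Fin A → Status) :=
  indep fun k => match col k with
    | some r => (coin (P.p n)).map fun real => if real then some r else none
    | none => (coin (P.q n)).map fun real => if real then some false else none

/-- The law of the column at position `j`, when the column `col` moves there: the actual arrivals
are revealed at the position with exactly `τ n` slots left. -/
noncomputable def enter (n : Fin N) (j : Fin (S.τ n + S.D n)) (col : PMF (Fin A → Status)) :
    PMF (Fin A → Status) :=
  if (j : ℕ) + 1 = S.τ n then col.bind (P.reveal n) else col

/-- The state at the beginning of the first slot: the packets of this slot and the predictions of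
the following ones, and no older packets. -/
noncomputable def start : PMF (State S) :=
  indep fun n => indep fun j =>
    if S.τ n ≤ (j : ℕ) + 1 then P.enter n j (P.fresh n) else PMF.pure fun _ => none

/-- The state at the beginning of the next slot, from the state `s` after the transmissions: the
remaining times decrease by one, packets whose deadline is reached are discarded, and the last
column of the prediction window (of the system, if `D n = 0`) is filled with a new one. -/
noncomputable def next (s : State S) : PMF (State S) :=
  indep fun n => indep fun j =>
    P.enter n j (if h : (j : ℕ) + 1 < S.τ n + S.D n then PMF.pure (s n ⟨j + 1, h⟩) else P.fresh n)

end Prediction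

/-- A randomized, history-dependent scheduling policy: the law of the decision, given the records of
all earlier slots (the latest one first) and the current state. -/
abbrev Policy (S : StaticSystem N A) : Type := List (Record S) → State S → PMF (Action S)

/-- The resource spent on user `n` in one slot, `E_n(t)`: the number of transmissions. -/
def Record.energy {S : StaticSystem N A} (r : Record S) (n : Fin N) : ℕ :=
  ∑ j, ∑ k, if r.before n j k = some false ∧ r.action n j k = true then 1 else 0

/-- The number of packets timely delivered to user `n` in one slot, `X_n(t)`: the packets in the
system that are received in this slot, and the packets arriving in this slot that had been received
during the prediction window. -/
def Record.delivered {S : StaticSystem N A} (r : Record S) (n : Fin N) : ℕ :=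
  ∑ j : Fin (S.τ n + S.D n), ∑ k,
    if ((j : ℕ) + 1 ≤ S.τ n ∧ r.before n j k = some false ∧ r.after n j k = some true) ∨
      ((j : ℕ) + 1 = S.τ n ∧ r.before n j k = some true) then 1 else 0

namespace Prediction

variable {S : StaticSystem N A} (P : Prediction S) (π : Policy S)

/-- The law of the records of the first `T` slots (the latest one first) and of the state at the
beginning of slot `T + 1`. -/
noncomputable def history : ℕ → PMF (List (Record S) × State S)
  | 0 => P.start.map fun s => ([], s)
  | T + 1 => (history T).bind fun x => (π x.1 x.2).bind fun u =>
      (transmit S x.2 u).bind fun s => (P.next s).map fun s' => (⟨x.2, u, s⟩ :: x.1, s')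

/-- The expectation of the sum of `f` over the first `T` slots. -/
noncomputable def expectedTotal (f : Record S → ℕ) (T : ℕ) : ℝ≥0∞ :=
  ∑' x, P.history π T x * ((x.1.map f).sum : ℕ)

/-- The timely-throughput `x_n` of user `n`. -/
noncomputable def throughput (n : Fin N) : ℝ≥0∞ :=
  Filter.liminf (fun T : ℕ => P.expectedTotal π (fun r => r.delivered n) T / T) Filter.atTop

/-- The average resource expenditure `E_av`. -/
noncomputable def resource : ℝ≥0∞ :=
  Filter.limsup (fun T : ℕ => P.expectedTotal π (fun r => ∑ n, r.energy n) T / T) Filter.atTop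

/-- The optimal weighted timely-throughput `φ*_I` subject to the average resource constraint. -/
noncomputable def optimalThroughput : ℝ≥0∞ :=
  ⨆ (π : Policy S) (_ : P.resource π ≤ S.B), ∑ n, (S.β n : ℝ≥0∞) * P.throughput π n

end Prediction

end TimelyThroughput

/-! The better prediction `P` can simulate the worse one, `P'`. Pass the predictions of `P'` through
a binary channel with rates `hit` and `miss`, chosen so that following it with the channel of `P`
gives the channel of `P'`. Since the channel of `P` to the arrivals is injective on laws
(`bind_actualGiven_injective`), the outcome has the law of the predictions of `P` (`predicted_eq`).

This couples the two systems: the second (`P`) drives the arrivals and imitates every transmission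
of the first (`P'`), as far as it sees the packet. Packets in the system then always have the same
status in both, so deliveries coincide and the second system spends no more.

Each marginal of the coupling needs an argument. For the first, the kernel `linkState` intertwines
the dynamics of `P'` with those of the pair (`start_bind_linkState`, `transmit_bind_linkState`,
`next_bind_linkState`), so the first history has the right law (`pairHistory_map_left`). For the
second, the imitating decision depends on the unseen state of the first system; it is replaced by
its conditional law given the second system's own history (`exists_policy`). -/

namespace TimelyThroughput

/-! ### Discrete laws -/

section PMFLemmas

variable {α β γ : Type*}

lemma pmf_bind_congr (μ : PMF α) {f g : α → PMF β} (h : ∀ a ∈ μ.support, f a = g a) :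
    μ.bind f = μ.bind g := by
  ext b
  simp only [PMF.bind_apply]
  refine tsum_congr fun a => ?_
  by_cases ha : μ a = 0
  · simp [ha]
  · rw [h a ((PMF.mem_support_iff _ _).2 ha)]

lemma tsum_bind_mul (μ : PMF α) (κ : α → PMF β) (g : β → ℝ≥0∞) :
    ∑' b, μ.bind κ b * g b = ∑' a, μ a * ∑' b, κ a b * g b := by
  simp only [PMF.bind_apply, ← ENNReal.tsum_mul_right, ← ENNReal.tsum_mul_left]
  rw [ENNReal.tsum_comm]
  simp only [mul_assoc]

lemma tsum_pure_mul (a : α) (g : α → ℝ≥0∞) : ∑' b, PMF.pure a b * g b = g a := by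
  rw [tsum_eq_single a]
  · simp
  · intro b hb
    simp [PMF.pure_apply, hb]

lemma tsum_map_mul (μ : PMF α) (φ : α → β) (g : β → ℝ≥0∞) :
    ∑' b, μ.map φ b * g b = ∑' a, μ a * g (φ a) := by
  simp only [PMF.map, tsum_bind_mul, Function.comp, tsum_pure_mul]

/-- Disintegration of a discrete law on a product. -/
lemma exists_disintegration (μ : PMF (α × β)) :
    ∃ κ : α → PMF β, μ = (μ.map Prod.fst).bind fun a => (κ a).map (Prod.mk a) := by
  classical
  obtain ⟨x₀, -⟩ := μ.support_nonempty
  have hfst : ∀ a, μ.map Prod.fst a = ∑' b, μ (a, b) := by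
    intro a
    rw [PMF.map_apply, ENNReal.tsum_prod', tsum_eq_single a]
    · simp
    · intro a' h
      simp [Ne.symm h]
  have hne : ∀ a, ∑' b, μ (a, b) ≠ ∞ := fun a => by
    rw [← hfst]
    exact PMF.apply_ne_top _ _
  -- The conditional law given `a`; on null `a` any law will do, and `x₀` supplies a point.
  refine ⟨fun a => if h : ∑' b, μ (a, b) = 0 then PMF.pure x₀.2
    else PMF.normalize (fun b => μ (a, b)) h (hne a), ?_⟩
  ext ⟨a, b⟩
  rw [PMF.bind_apply, tsum_eq_single a]
  · have hmap : ∀ κ : PMF β, κ.map (Prod.mk a) (a, b) = κ b := by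
      intro κ
      rw [PMF.map_apply, tsum_eq_single b]
      · simp
      · intro b' hb
        simp [Ne.symm hb]
    rw [hfst, hmap]
    by_cases h : ∑' b, μ (a, b) = 0
    · have := ENNReal.tsum_eq_zero.1 h b
      simp [h, this]
    · simp only [h, dite_false, PMF.normalize_apply]
      rw [mul_left_comm, ENNReal.mul_inv_cancel h (hne a), mul_one]
  · intro a' ha
    rw [PMF.map_apply]
    simp [Ne.symm ha]

end PMFLemmas

section Indep

variable {ι : Type*} [Fintype ι] [DecidableEq ι] {α β : ι → Type*}
  [∀ i, Fintype (α i)] [∀ i, Fintype (β i)]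

lemma indep_apply (m : ∀ i, PMF (α i)) (x : ∀ i, α i) : indep m x = ∏ i, m i (x i) := rfl

lemma mem_support_indep {m : ∀ i, PMF (α i)} {x : ∀ i, α i} :
    x ∈ (indep m).support ↔ ∀ i, x i ∈ (m i).support := by
  simp [PMF.mem_support_iff, indep_apply, Finset.prod_ne_zero_iff]

lemma indep_bind (m : ∀ i, PMF (α i)) (κ : ∀ i, α i → PMF (β i)) :
    (indep m).bind (fun x => indep fun i => κ i (x i)) = indep fun i => (m i).bind (κ i) := by
  ext y
  simp only [PMF.bind_apply, indep_apply, tsum_fintype, ← Finset.prod_mul_distrib]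
  rw [Finset.prod_univ_sum, Fintype.piFinset_univ]

lemma indep_pure (x : ∀ i, α i) : indep (fun i => PMF.pure (x i)) = PMF.pure x := by
  classical
  ext y
  rw [indep_apply, PMF.pure_apply]
  split_ifs with h
  · subst h
    simp
  · obtain ⟨i, hi⟩ := Function.ne_iff.1 h
    exact Finset.prod_eq_zero (Finset.mem_univ i) (by simp [PMF.pure_apply, hi])

lemma indep_map (m : ∀ i, PMF (α i)) (f : ∀ i, α i → β i) :
    (indep m).map (fun x i => f i (x i)) = indep fun i => (m i).map (f i) := by
  have h := indep_bind m fun i a => PMF.pure (f i a)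
  simp only [indep_pure] at h
  exact h

end Indep

/-! ### Coins, binary channels and their inverses -/

lemma coin_apply (r : unitInterval) (b : Bool) :
    coin r b = ENNReal.ofReal (if b then (r : ℝ) else 1 - r) := rfl

lemma coin_one : coin 1 = PMF.pure true := by
  ext b
  cases b <;> simp [coin_apply, PMF.pure_apply]

lemma coin_zero : coin 0 = PMF.pure false := by
  ext b
  cases b <;> simp [coin_apply, PMF.pure_apply]

lemma coin_bind_coin {h p q r : unitInterval} (hr : (h : ℝ) * p + (1 - h) * q = r) :
    ((coin h).bind fun c => coin (if c then p else q)) = coin r := by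
  have h0 := h.2.1
  have h1 : (0 : ℝ) ≤ 1 - h := by linarith [h.2.2]
  have p0 := p.2.1
  have p1 : (0 : ℝ) ≤ 1 - p := by linarith [p.2.2]
  have q0 := q.2.1
  have q1 : (0 : ℝ) ≤ 1 - q := by linarith [q.2.2]
  ext b
  rw [PMF.bind_apply, tsum_fintype, Fintype.sum_bool]
  simp only [coin_apply, if_true, Bool.false_eq_true, if_false]
  cases b
  · simp only [Bool.false_eq_true, if_false]
    rw [← ENNReal.ofReal_mul h0, ← ENNReal.ofReal_mul h1,
      ← ENNReal.ofReal_add (mul_nonneg h0 p1) (mul_nonneg h1 q1), ← hr]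
    congr 1
    ring
  · simp only [if_true]
    rw [← ENNReal.ofReal_mul h0, ← ENNReal.ofReal_mul h1,
      ← ENNReal.ofReal_add (mul_nonneg h0 p0) (mul_nonneg h1 q0), ← hr]

variable {N A : ℕ}

lemma actualGiven_bind {h₁ h₀ p q p' q' : unitInterval}
    (hp : (h₁ : ℝ) * p + (1 - h₁) * q = p') (hq : (h₀ : ℝ) * p + (1 - h₀) * q = q')
    (b : Fin A → Bool) :
    (actualGiven h₁ h₀ b).bind (actualGiven p q) = actualGiven p' q' b := by
  unfold actualGiven
  rw [indep_bind (α := fun _ : Fin A => Bool) (β := fun _ => Bool) _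
    fun _ c => coin (if c then p else q)]
  congr 1
  funext k
  cases b k
  · exact coin_bind_coin hq
  · exact coin_bind_coin hp

/-- The channel from the predictions to the actual arrivals is injective on laws. -/
lemma bind_actualGiven_injective {p q : unitInterval} (hqp : q < p) :
    Function.Injective fun μ : PMF (Fin A → Bool) => μ.bind (actualGiven p q) := by
  have hne : (p : ℝ) - q ≠ 0 := sub_ne_zero.2 (ne_of_gt hqp)
  -- `K` is the 2 × 2 stochastic matrix of one packet, with determinant `p - q`, and `L` is its
  -- inverse. The channel on `A` packets is a tensor power of `K`, inverted by the same power of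
  -- `L`.
  let K : Bool → Bool → ℝ := fun b a => (coin (if b then p else q) a).toReal
  let L : Bool → Bool → ℝ := fun a c =>
    (if a then (if c then 1 - (q : ℝ) else p - 1) else (if c then -(q : ℝ) else p)) / (p - q)
  have hK : ∀ b a, K b a = if a then ((if b then p else q : unitInterval) : ℝ)
      else 1 - ((if b then p else q : unitInterval) : ℝ) := by
    intro b a
    simp only [K, coin_apply]
    apply ENNReal.toReal_ofReal
    have := (if b then p else q : unitInterval).2
    cases a
    · rw [if_neg Bool.false_ne_true]
      linarith [this.2]
    · exact this.1
  have hKL : ∀ b c, ∑ a, K b a * L a c = if b = c then 1 else 0 := by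
    intro b c
    rw [Fintype.sum_bool]
    cases b <;> cases c <;> simp [hK, L] <;> field_simp <;> ring
  have key : ∀ (μ : PMF (Fin A → Bool)) (c : Fin A → Bool),
      ∑ x, (μ.bind (actualGiven p q) x).toReal * ∏ k, L (x k) (c k) = (μ c).toReal := by
    intro μ c
    have h1 : ∀ x, (μ.bind (actualGiven p q) x).toReal
        = ∑ b, (μ b).toReal * ∏ k, K (b k) (x k) := by
      intro x
      rw [PMF.bind_apply, tsum_fintype, ENNReal.toReal_sum fun b _ =>
        ENNReal.mul_ne_top (PMF.apply_ne_top _ _) (PMF.apply_ne_top _ _)]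
      refine Finset.sum_congr rfl fun b _ => ?_
      rw [ENNReal.toReal_mul, actualGiven, indep_apply, ENNReal.toReal_prod]
    have h2 : ∀ b : Fin A → Bool, ∑ x : Fin A → Bool, ∏ k, (K (b k) (x k) * L (x k) (c k))
        = if b = c then 1 else 0 := by
      intro b
      have h := Finset.prod_univ_sum (fun _ : Fin A => (Finset.univ : Finset Bool))
        (fun k a => K (b k) a * L a (c k))
      rw [Fintype.piFinset_univ] at h
      rw [← h]
      simp only [hKL]
      split_ifs with hbc
      · subst hbc
        simp
      · obtain ⟨k, hk⟩ := Function.ne_iff.1 hbc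
        exact Finset.prod_eq_zero (Finset.mem_univ k) (by simp [hk])
    simp only [h1, Finset.sum_mul]
    rw [Finset.sum_comm]
    simp only [mul_assoc, ← Finset.prod_mul_distrib, ← Finset.mul_sum, h2]
    simp
  intro μ ν h
  ext c
  rw [← ENNReal.toReal_eq_toReal_iff' (PMF.apply_ne_top _ _) (PMF.apply_ne_top _ _),
    ← key μ c, ← key ν c]
  simp only at h
  rw [h]

lemma map_const_eq_pure {α β : Type*} (μ : PMF α) (b : β) :
    μ.map (fun _ => b) = PMF.pure b := PMF.map_const μ b

/-- Independent columns that move by one position, where a new one takes the last place. -/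
lemma indep_bind_shift {α β : Type*} [Fintype α] [Fintype β] {L : ℕ} (m : Fin L → PMF α)
    (κ : Fin L → α → PMF β) (φ : Fin L → PMF β) :
    (indep m).bind (fun x => indep fun j : Fin L =>
        if h : (j : ℕ) + 1 < L then κ j (x ⟨j + 1, h⟩) else φ j) =
      indep fun j : Fin L => if h : (j : ℕ) + 1 < L then (m ⟨j + 1, h⟩).bind (κ j) else φ j := by
  cases L with
  | zero =>
    have h : ∀ x y : Fin 0 → PMF β, x = y := fun x y => Subsingleton.elim x y
    rw [h (fun j : Fin 0 => if h : (j : ℕ) + 1 < 0 then (m ⟨j + 1, h⟩).bind (κ j) else φ j) φ,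
      ← PMF.bind_const (indep m) (indep φ)]
    congr 1
  | succ l =>
    ext y
    -- The product is reindexed by the source column: column `i + 1` feeds position `i`. Column `0`
    -- is dropped and integrates to one, so its slot can hold the constant factor of the new last
    -- column.
    let F : Fin (l + 1) → α → ℝ≥0∞ := Fin.cases (fun _ => φ (Fin.last l) (y (Fin.last l)))
      fun i a => κ i.castSucc a (y i.castSucc)
    have hF : ∀ x : Fin (l + 1) → α, (∏ j : Fin (l + 1), (if h : (j : ℕ) + 1 < l + 1 then
        κ j (x ⟨j + 1, h⟩) else φ j) (y j)) = ∏ i, F i (x i) := by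
      intro x
      rw [Fin.prod_univ_castSucc, Fin.prod_univ_succ, mul_comm]
      congr 1
      · simp [F]
      · refine Finset.prod_congr rfl fun i _ => ?_
        simp only [Fin.val_castSucc, Nat.add_lt_add_iff_right, i.isLt, dite_true, F, Fin.cases_succ]
        rfl
    have hR : (∏ j : Fin (l + 1), (if h : (j : ℕ) + 1 < l + 1 then
        (m ⟨j + 1, h⟩).bind (κ j) else φ j) (y j)) = ∏ i, ∑ a, m i a * F i a := by
      rw [Fin.prod_univ_castSucc, Fin.prod_univ_succ, mul_comm]
      congr 1
      · simp only [F, Fin.cases_zero, ← Finset.sum_mul]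
        rw [← tsum_fintype (L := .unconditional _), PMF.tsum_coe, one_mul]
        simp
      · refine Finset.prod_congr rfl fun i _ => ?_
        simp only [Fin.val_castSucc, Nat.add_lt_add_iff_right, i.isLt, dite_true, F, Fin.cases_succ,
          PMF.bind_apply, tsum_fintype]
        rfl
    simp only [PMF.bind_apply, indep_apply, tsum_fintype] at hR ⊢
    simp only [hF, hR, ← Finset.prod_mul_distrib]
    rw [Finset.prod_univ_sum, Fintype.piFinset_univ]

/-! ### Product laws on states -/

section Nested

variable {S : StaticSystem N A} {α β : Type*} [Fintype α] [Fintype β]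

lemma indep_bind₂ (μ : ∀ n, Fin (S.τ n + S.D n) → PMF α)
    (κ : ∀ n, Fin (S.τ n + S.D n) → α → PMF β) :
    (indep fun n => indep fun j => μ n j).bind
        (fun x => indep fun n => indep fun j => κ n j (x n j)) =
      indep fun n => indep fun j => (μ n j).bind (κ n j) := by
  rw [indep_bind (α := fun n => Fin (S.τ n + S.D n) → α) (β := fun n => Fin (S.τ n + S.D n) → β)
    (fun n => indep fun j => μ n j) fun n x => indep fun j => κ n j (x j)]
  congr 1
  funext n
  exact indep_bind (α := fun _ : Fin (S.τ n + S.D n) => α) (β := fun _ => β) (μ n) (κ n)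

lemma indep_bind₃ (μ : ∀ n, Fin (S.τ n + S.D n) → Fin A → PMF α)
    (κ : ∀ n, Fin (S.τ n + S.D n) → Fin A → α → PMF β) :
    (indep fun n => indep fun j => indep fun k => μ n j k).bind
        (fun x => indep fun n => indep fun j => indep fun k => κ n j k (x n j k)) =
      indep fun n => indep fun j => indep fun k => (μ n j k).bind (κ n j k) := by
  rw [indep_bind₂ (fun n j => indep fun k => μ n j k) fun n j x => indep fun k => κ n j k (x k)]
  congr 1
  funext n
  congr 1
  funext j
  exact indep_bind (α := fun _ : Fin A => α) (β := fun _ => β) (μ n j) (κ n j)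

lemma indep_map₂ (μ : ∀ n, Fin (S.τ n + S.D n) → PMF α)
    (f : ∀ n, Fin (S.τ n + S.D n) → α → β) :
    (indep fun n => indep fun j => μ n j).map (fun x n j => f n j (x n j)) =
      indep fun n => indep fun j => (μ n j).map (f n j) := by
  have h := indep_bind₂ μ fun n j a => PMF.pure (f n j a)
  simp only [indep_pure] at h
  exact h

lemma indep_map₃ (μ : ∀ n, Fin (S.τ n + S.D n) → Fin A → PMF α)
    (f : ∀ n, Fin (S.τ n + S.D n) → Fin A → α → β) :
    (indep fun n => indep fun j => indep fun k => μ n j k).map (fun x n j k => f n j k (x n j k)) =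
      indep fun n => indep fun j => indep fun k => (μ n j k).map (f n j k) := by
  have h := indep_bind₃ μ fun n j k a => PMF.pure (f n j k a)
  simp only [indep_pure] at h
  exact h

end Nested

/-! ### Pairs of states -/

/-- The states of two systems, side by side. -/
abbrev PairState (S : StaticSystem N A) : Type :=
  ∀ n : Fin N, Fin (S.τ n + S.D n) → Fin A → Status × Status

namespace PairState

variable {S : StaticSystem N A}

/-- The state of the first system. -/
def fst (z : PairState S) : State S := fun n j k => (z n j k).1

/-- The state of the second system. -/
def snd (z : PairState S) : State S := fun n j k => (z n j k).2

/-- The packets that have entered the system have the same status in both systems. -/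
def Agree (z : PairState S) : Prop :=
  ∀ n (j : Fin (S.τ n + S.D n)) k, (j : ℕ) < S.τ n → (z n j k).1 = (z n j k).2

/-- The decision in the second system that imitates the decision `u` in the first one: transmit
what the first system transmits. -/
def imitate (z : PairState S) (u : Action S) : Action S :=
  fun n j k => decide ((z n j k).1 = some false) && u n j k

end PairState

/-! ### Coupled transmission and arrival of one packet -/

/-- One transmission in both systems. The outcome is the same in both, and fictitious in the second
one if it does not have the packet. -/
noncomputable def pairAttempt (ζ : unitInterval) (z : Status × Status) (u : Bool) :
    PMF (Status × Status) :=
  if z.1 = some false ∧ u = true then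
    (coin ζ).map fun c => (some c, if z.2 = some false then some c else z.2)
  else PMF.pure z

/-- The transmissions of one slot in both systems. -/
noncomputable def pairTransmit (S : StaticSystem N A) (z : PairState S) (u : Action S) :
    PMF (PairState S) :=
  indep fun n => indep fun j => indep fun k => pairAttempt (S.ζ n) (z n j k) (u n j k)

/-- A fictitious attempt leaves no trace in the second component, which therefore evolves as a
genuine system under the imitating decision. -/
lemma pairTransmit_map_snd {S : StaticSystem N A} (z : PairState S) (u : Action S) :
    (pairTransmit S z u).map PairState.snd = transmit S z.snd (z.imitate u) := by
  refine (indep_map₃ _ fun _ _ _ => Prod.snd).trans ?_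
  unfold transmit
  congr! 6 with n j k
  unfold pairAttempt PairState.snd PairState.imitate
  obtain ⟨a, b⟩ := z n j k
  by_cases ha : a = some false <;> by_cases hb : b = some false <;> cases u n j k <;>
    simp [ha, hb, PMF.map_comp, PMF.pure_map, Function.comp_def, map_const_eq_pure]

/-- The links between a packet of the first system and the same packet of the second one, in the
prediction window. -/
noncomputable def link (h₁ h₀ : unitInterval) : Status → PMF (Status × Status)
  | some r => (coin h₁).map fun c => (some r, if c then some r else none)
  | none => (coin h₀).map fun c => (none, if c then some false else none)

lemma link_map_fst (h₁ h₀ : unitInterval) (w : Status) :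
    (link h₁ h₀ w).map Prod.fst = PMF.pure w := by
  cases w <;> simp [link, PMF.map_comp, Function.comp_def, map_const_eq_pure]

/-- The coin deciding whether the second system sees a packet ignores its reception status, so it
may be tossed before or after the attempt. -/
lemma link_bind_pairAttempt (h₁ h₀ ζ : unitInterval) (w : Status) (u : Bool) :
    (link h₁ h₀ w).bind (fun z => pairAttempt ζ z u) =
      (if w = some false ∧ u = true then (coin ζ).map some else PMF.pure w).bind (link h₁ h₀) := by
  by_cases hw : w = some false ∧ u = true
  · obtain ⟨rfl, rfl⟩ := hw
    simp only [link, PMF.bind_map, Function.comp_def, pairAttempt, and_self, if_true]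
    simp only [PMF.map, Function.comp_def]
    rw [PMF.bind_comm]
    congr! 4 with c d
    cases d <;> simp
  · rw [if_neg hw, PMF.pure_bind]
    have h : ∀ z ∈ (link h₁ h₀ w).support, pairAttempt ζ z u = PMF.pure z := by
      intro z hz
      have h1 : z.1 = w := by
        have : z.1 ∈ ((link h₁ h₀ w).map Prod.fst).support :=
          (PMF.mem_support_map_iff _ _ _).2 ⟨z, hz, rfl⟩
        rw [link_map_fst] at this
        simpa using this
      rw [pairAttempt, h1, if_neg hw]
    rw [pmf_bind_congr _ h, PMF.bind_pure]

/-- The arrival or false alarm of a potential packet. -/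
noncomputable def revealEntry (p q : unitInterval) : Status → PMF Status
  | some r => (coin p).map fun real => if real then some r else none
  | none => (coin q).map fun real => if real then some false else none

lemma link_bind_revealEntry {h₁ h₀ p q p' q' : unitInterval}
    (hp : (h₁ : ℝ) * p + (1 - h₁) * q = p') (hq : (h₀ : ℝ) * p + (1 - h₀) * q = q')
    (h : h₁ = 1 ∨ q = 0) (w : Status) :
    (link h₁ h₀ w).bind (fun z => revealEntry p q z.2) = revealEntry p' q' w := by
  cases w with
  | none =>
    simp only [link, PMF.bind_map, revealEntry, ← coin_bind_coin hq, PMF.map_bind,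
      Function.comp_def]
    congr! 2 with c
    cases c <;> simp
  | some r =>
    simp only [link, PMF.bind_map, revealEntry, ← coin_bind_coin hp, PMF.map_bind,
      Function.comp_def]
    -- A packet predicted only by the first system could already be received there, yet would arrive
    -- at the source in the second. Either there is no such packet (`h₁ = 1`), or it never arrives
    -- (`q = 0`).
    rcases h with rfl | rfl
    · simp [coin_one, PMF.pure_bind]
    · congr! 2 with c
      cases c <;> simp [coin_zero, PMF.pure_map]

/-! ### Degraded predictions and the intertwining kernel -/

namespace Prediction

variable {S : StaticSystem N A}

lemma reveal_eq (P : Prediction S) (n : Fin N) (col : Fin A → Status) :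
    P.reveal n col = indep fun k => revealEntry (P.p n) (P.q n) (col k) := by
  unfold reveal
  congr! 2 with k

/-- The prediction `P'` is a degraded version of the prediction `P`: independently for all potential
packets, a packet predicted by `P'` is predicted by `P` with probability `hit`, and a packet not
predicted by `P'` is predicted by `P` with probability `miss`. -/
structure Degradation (P' P : Prediction S) where
  hit : Fin N → unitInterval
  miss : Fin N → unitInterval
  hit_eq : ∀ n, (hit n : ℝ) * P.p n + (1 - hit n) * P.q n = P'.p n
  miss_eq : ∀ n, (miss n : ℝ) * P.p n + (1 - miss n) * P.q n = P'.q n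
  sound : ∀ n, hit n = 1 ∨ P.q n = 0

namespace Degradation

variable {P' P : Prediction S} (d : Degradation P' P)

/-- Followed by the channel of `P`, both sides become the given arrival law, and that channel is
injective. -/
lemma predicted_eq (d : Degradation P' P) (n : Fin N) :
    P.predicted n = (P'.predicted n).bind (actualGiven (d.hit n) (d.miss n)) := by
  apply bind_actualGiven_injective (P.q_lt_p n)
  simp only [PMF.bind_bind, actualGiven_bind (d.hit_eq n) (d.miss_eq n), P.consistent,
    P'.consistent]

/-- The law of the column of pairs at position `i`, given the column of the first system. -/
noncomputable def linkColumn (n : Fin N) (i : ℕ) (col : Fin A → Status) :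
    PMF (Fin A → Status × Status) :=
  indep fun k => if S.τ n ≤ i then link (d.hit n) (d.miss n) (col k) else PMF.pure (col k, col k)

/-- The law of the pair of states, given the state of the first system. -/
noncomputable def linkState (s : State S) : PMF (PairState S) :=
  indep fun n => indep fun j => d.linkColumn n j (s n j)

/-- The column of newly predicted packets, in both systems. -/
noncomputable def freshPair (n : Fin N) : PMF (Fin A → Status × Status) :=
  (P'.fresh n).bind fun col => indep fun k => link (d.hit n) (d.miss n) (col k)

/-- The law of the column of pairs at position `j`, when the column `col` moves there: the arrivals
are those of the second system, and the first system takes over the status of the packets. -/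
noncomputable def enterPair (P : Prediction S) (n : Fin N) (j : Fin (S.τ n + S.D n))
    (col : PMF (Fin A → Status × Status)) : PMF (Fin A → Status × Status) :=
  if (j : ℕ) + 1 = S.τ n then
    col.bind fun c => indep fun k => (revealEntry (P.p n) (P.q n) (c k).2).map fun s => (s, s)
  else col

/-- The pair of states at the beginning of the first slot. -/
noncomputable def startPair : PMF (PairState S) :=
  indep fun n => indep fun j =>
    if S.τ n ≤ (j : ℕ) + 1 then enterPair P n j (d.freshPair n)
    else PMF.pure fun _ => (none, none)

/-- The pair of states at the beginning of the next slot. -/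
noncomputable def nextPair (z : PairState S) : PMF (PairState S) :=
  indep fun n => indep fun j =>
    enterPair P n j
      (if h : (j : ℕ) + 1 < S.τ n + S.D n then PMF.pure (z n ⟨j + 1, h⟩) else d.freshPair n)

lemma freshPair_map_snd (n : Fin N) :
    (d.freshPair n).map (fun c k => (c k).2) = P.fresh n := by
  unfold freshPair fresh
  rw [d.predicted_eq n, PMF.map_bind, PMF.bind_map, PMF.map_bind]
  congr 1
  funext b
  unfold actualGiven
  simp only [Function.comp_def]
  rw [indep_map (α := fun _ : Fin A => Status × Status) (β := fun _ => Status) _ fun _ => Prod.snd,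
    indep_map (α := fun _ : Fin A => Bool) (β := fun _ => Status) _
      fun _ c => if c then some false else none]
  congr 1
  funext k
  cases b k <;> simp [link, PMF.map_comp, Function.comp_def]

lemma enterPair_map_snd (n : Fin N) (j : Fin (S.τ n + S.D n))
    (col : PMF (Fin A → Status × Status)) :
    (enterPair P n j col).map (fun c k => (c k).2) =
      P.enter n j (col.map fun c k => (c k).2) := by
  unfold enterPair enter
  split_ifs
  · rw [PMF.map_bind, PMF.bind_map]
    congr 1
    funext c
    rw [indep_map (α := fun _ : Fin A => Status × Status) (β := fun _ => Status) _
      fun _ => Prod.snd, Function.comp_apply, reveal_eq]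
    simp only [PMF.map_comp, Function.comp_def]
    congr! 2
    exact PMF.map_id _
  · rfl

lemma bind_enterPair_pure (n : Fin N) (j : Fin (S.τ n + S.D n))
    (col : PMF (Fin A → Status × Status)) :
    col.bind (fun c => enterPair P n j (PMF.pure c)) = enterPair P n j col := by
  unfold enterPair
  split_ifs
  · simp only [PMF.pure_bind]
  · exact PMF.bind_pure _

lemma startPair_map_snd : d.startPair.map PairState.snd = P.start := by
  refine (indep_map₂ _ fun n j (c : Fin A → Status × Status) k => (c k).2).trans ?_
  unfold start
  congr! 4 with n j
  split_ifs
  · rw [enterPair_map_snd, freshPair_map_snd]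
  · rw [PMF.pure_map]

lemma nextPair_map_snd (z : PairState S) : (d.nextPair z).map PairState.snd = P.next z.snd := by
  refine (indep_map₂ _ fun n j (c : Fin A → Status × Status) k => (c k).2).trans ?_
  unfold next
  congr! 4 with n j
  rw [enterPair_map_snd]
  congr 1
  split_ifs
  · rw [PMF.pure_map]
    rfl
  · rw [freshPair_map_snd]

/-- The intertwining for one column: linking after the move equals linking at the previous position
`j + 1` and moving the pair. On entry this is `link_bind_revealEntry`. -/
lemma enter_bind_linkColumn (n : Fin N) (j : Fin (S.τ n + S.D n)) (col : PMF (Fin A → Status)) :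
    (P'.enter n j col).bind (d.linkColumn n j) =
      enterPair P n j (col.bind (d.linkColumn n (j + 1))) := by
  unfold enterPair enter
  split_ifs with h
  · simp only [PMF.bind_bind]
    congr 1
    funext c
    rw [reveal_eq]
    have h1 : ¬ S.τ n ≤ j := by omega
    have h2 : S.τ n ≤ (j : ℕ) + 1 := by omega
    simp only [linkColumn, h2, if_true]
    have h3 : d.linkColumn n j = fun c : Fin A → Status =>
        indep fun k => PMF.pure (c k, c k) := by
      funext c
      simp only [linkColumn, h1, if_false]
    rw [h3, indep_bind (α := fun _ : Fin A => Status) (β := fun _ => Status × Status) _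
        fun _ s => PMF.pure (s, s),
      indep_bind (α := fun _ : Fin A => Status × Status) (β := fun _ => Status × Status) _
        fun _ z => (revealEntry (P.p n) (P.q n) z.2).map fun s => (s, s)]
    congr 1
    funext k
    rw [← link_bind_revealEntry (d.hit_eq n) (d.miss_eq n) (d.sound n), PMF.bind_bind]
    rfl
  -- Away from the entry position the column stays on the same side of the window's boundary.
  · have h1 : S.τ n ≤ (j : ℕ) + 1 ↔ S.τ n ≤ j := by omega
    congr 1
    funext c
    simp only [linkColumn, h1]

lemma freshPair_eq {n : Fin N} {i : ℕ} (hi : S.τ n ≤ i) :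
    d.freshPair n = (P'.fresh n).bind (d.linkColumn n i) := by
  unfold freshPair linkColumn
  simp only [hi, if_true]

lemma start_bind_linkState : P'.start.bind d.linkState = d.startPair := by
  refine (indep_bind₂ _ fun n j => d.linkColumn n j).trans ?_
  unfold startPair
  congr! 4 with n j
  split_ifs with h
  · rw [enter_bind_linkColumn, freshPair_eq d h]
  · rw [PMF.pure_bind, linkColumn]
    have h1 : ¬ S.τ n ≤ j := by omega
    simp only [h1, if_false]
    exact indep_pure _

lemma next_bind_linkState (s : State S) :
    (P'.next s).bind d.linkState = (d.linkState s).bind d.nextPair := by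
  have hL : (P'.next s).bind d.linkState = indep fun n => indep fun j =>
      enterPair P n j (if h : (j : ℕ) + 1 < S.τ n + S.D n then
        d.linkColumn n (j + 1) (s n ⟨j + 1, h⟩) else d.freshPair n) := by
    refine (indep_bind₂ _ fun n j => d.linkColumn n j).trans ?_
    congr! 4 with n j
    rw [enter_bind_linkColumn]
    split_ifs with h
    · rw [PMF.pure_bind]
    -- The new column is linked as if it came from position `τ n + D n`, just beyond the last one.
    · rw [freshPair_eq d (i := j + 1) (by omega)]
  rw [hL]
  unfold linkState
  have hN : d.nextPair = fun x => indep fun n => indep fun j : Fin (S.τ n + S.D n) =>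
      if h : (j : ℕ) + 1 < S.τ n + S.D n then enterPair P n j (PMF.pure (x n ⟨j + 1, h⟩))
      else enterPair P n j (d.freshPair n) := by
    funext x
    simp only [nextPair, apply_dite (enterPair P _ _)]
  simp only [hN, apply_dite (enterPair P _ _)]
  rw [indep_bind (α := fun n => Fin (S.τ n + S.D n) → Fin A → Status × Status)
    (β := fun n => Fin (S.τ n + S.D n) → Fin A → Status × Status)
    (fun n => indep fun j => d.linkColumn n j (s n j))
    fun n x => indep fun j : Fin (S.τ n + S.D n) => if h : (j : ℕ) + 1 < S.τ n + S.D n then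
      enterPair P n j (PMF.pure (x ⟨j + 1, h⟩)) else enterPair P n j (d.freshPair n)]
  congr 1
  funext n
  rw [indep_bind_shift (fun j : Fin (S.τ n + S.D n) => d.linkColumn n j (s n j))
    (fun j c => enterPair P n j (PMF.pure c)) fun j => enterPair P n j (d.freshPair n)]
  simp only [bind_enterPair_pure]

end Degradation

end Prediction

namespace Prediction

variable {S : StaticSystem N A} {P' P : Prediction S}

/-! ### The expected totals -/

lemma length_of_mem_support_history (P : Prediction S) (π : Policy S) (T : ℕ) :
    ∀ x ∈ (P.history π T).support, x.1.length = T := by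
  induction T with
  | zero =>
    intro x hx
    obtain ⟨s, -, rfl⟩ := (PMF.mem_support_map_iff _ _ _).1 hx
    rfl
  | succ T ih =>
    intro x hx
    obtain ⟨y, hy, hx⟩ := (PMF.mem_support_bind_iff _ _ _).1 hx
    obtain ⟨u, -, hx⟩ := (PMF.mem_support_bind_iff _ _ _).1 hx
    obtain ⟨s, -, hx⟩ := (PMF.mem_support_bind_iff _ _ _).1 hx
    obtain ⟨s', -, rfl⟩ := (PMF.mem_support_map_iff _ _ _).1 hx
    simp [ih y hy]

/-! ### The coupled history and its two marginals -/

namespace Degradation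

variable (d : Degradation P' P)

lemma agree_of_mem_support_linkState {s : State S} {z : PairState S}
    (hz : z ∈ (d.linkState s).support) : z.Agree ∧ z.fst = s := by
  have h : ∀ n (j : Fin (S.τ n + S.D n)) k, z n j k ∈ (if S.τ n ≤ (j : ℕ) then link (d.hit n) (d.miss n) (s n j k)
      else PMF.pure (s n j k, s n j k)).support := fun n j k =>
    mem_support_indep.1 (mem_support_indep.1 (mem_support_indep.1 hz n) j) k
  constructor
  · intro n j k hj
    have := h n j k
    rw [if_neg (by omega)] at this
    rw [(PMF.mem_support_pure_iff _ _).1 this]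
  · funext n j k
    have h1 := h n j k
    split_ifs at h1
    · have : (z n j k).1 ∈ ((link (d.hit n) (d.miss n) (s n j k)).map Prod.fst).support :=
        (PMF.mem_support_map_iff _ _ _).2 ⟨_, h1, rfl⟩
      rw [link_map_fst] at this
      exact (PMF.mem_support_pure_iff _ _).1 this
    · exact congrArg Prod.fst ((PMF.mem_support_pure_iff _ _).1 h1)

lemma linkState_bind_congr {β : Type*} (s : State S) {f g : PairState S → PMF β}
    (h : ∀ z, z.fst = s → f z = g z) : (d.linkState s).bind f = (d.linkState s).bind g :=
  pmf_bind_congr _ fun z hz => h z (d.agree_of_mem_support_linkState hz).2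

lemma transmit_bind_linkState (s : State S) (u : Action S) :
    (transmit S s u).bind d.linkState = (d.linkState s).bind fun z => pairTransmit S z u := by
  unfold linkState linkColumn transmit pairTransmit
  rw [indep_bind₃ _ fun n j k w => if S.τ n ≤ (j : ℕ) then link (d.hit n) (d.miss n) w
      else PMF.pure (w, w),
    indep_bind₃ _ fun n j k z => pairAttempt (S.ζ n) z (u n j k)]
  congr! 6 with n j k
  split_ifs with h1 h2 h2
  · rw [link_bind_pairAttempt, if_pos h1]
  · simp [pairAttempt, h1, PMF.map, Function.comp_def]
  · rw [link_bind_pairAttempt, if_neg h1]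
  · simp [pairAttempt, h1]

/-- The law of the histories of both systems in the first `T` slots, and of the pair of states at
the beginning of slot `T + 1`, when the second system imitates the policy `π` of the first one. -/
noncomputable def pairHistory (π : Policy S) :
    ℕ → PMF ((List (Record S) × List (Record S)) × PairState S)
  | 0 => d.startPair.map fun z => (([], []), z)
  | T + 1 => (pairHistory π T).bind fun x => (π x.1.1 x.2.fst).bind fun u =>
      (pairTransmit S x.2 u).bind fun z => (d.nextPair z).map fun z' =>
        ((⟨x.2.fst, u, z.fst⟩ :: x.1.1, ⟨x.2.snd, x.2.imitate u, z.snd⟩ :: x.1.2), z')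

/-- Given the first system's history, the pair depends only on the first system's current state. The
decision can thus be drawn before the link, which is then carried through transmission and arrival
by the intertwinings. -/
lemma pairHistory_map_left (π : Policy S) (T : ℕ) :
    (d.pairHistory π T).map (fun x => (x.1.1, x.2)) =
      (P'.history π T).bind fun y => (d.linkState y.2).map (Prod.mk y.1) := by
  induction T with
  | zero =>
    simp only [pairHistory, history, PMF.map_comp, PMF.bind_map, Function.comp_def,
      ← start_bind_linkState, PMF.map_bind]
  | succ T ih =>
    let step : List (Record S) × PairState S → PMF (List (Record S) × PairState S) := fun y =>
      (π y.1 y.2.fst).bind fun u => (pairTransmit S y.2 u).bind fun z =>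
        (d.nextPair z).map fun z' => (⟨y.2.fst, u, z.fst⟩ :: y.1, z')
    have h1 : (d.pairHistory π (T + 1)).map (fun x => (x.1.1, x.2)) =
        ((d.pairHistory π T).map fun x => (x.1.1, x.2)).bind step := by
      simp only [pairHistory, PMF.bind_map, PMF.map_bind, PMF.map_comp, Function.comp_def, step]
    rw [h1, ih, PMF.bind_bind]
    simp only [history, PMF.bind_bind]
    congr 1
    funext y
    obtain ⟨l, s⟩ := y
    calc ((d.linkState s).map (Prod.mk l)).bind step
        = (d.linkState s).bind fun z => (π l s).bind fun u => (pairTransmit S z u).bind fun z' =>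
            (d.nextPair z').map fun z'' => (⟨s, u, z'.fst⟩ :: l, z'') := by
          rw [PMF.bind_map]
          refine d.linkState_bind_congr s fun z hz => ?_
          simp only [Function.comp_apply, step, hz]
      _ = (π l s).bind fun u => ((d.linkState s).bind fun z => pairTransmit S z u).bind fun z' =>
            (d.nextPair z').map fun z'' => (⟨s, u, z'.fst⟩ :: l, z'') := by
          rw [PMF.bind_comm]
          simp only [PMF.bind_bind]
      _ = _ := by
          congr 1
          funext u
          rw [← transmit_bind_linkState, PMF.bind_bind]
          congr 1
          funext s'
          rw [PMF.bind_map]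
          calc _ = ((d.linkState s').bind d.nextPair).map fun z'' => (⟨s, u, s'⟩ :: l, z'') := by
                rw [PMF.map_bind]
                refine d.linkState_bind_congr s' fun z hz => ?_
                rw [hz]
            _ = _ := by
                rw [← next_bind_linkState, PMF.map_bind]
                rfl

lemma pairHistory_map_fst (π : Policy S) (T : ℕ) :
    (d.pairHistory π T).map (fun x => x.1.1) = (P'.history π T).map Prod.fst := by
  have h := congrArg (PMF.map Prod.fst) (d.pairHistory_map_left π T)
  simp only [PMF.map_comp, PMF.map_bind, Function.comp_def, map_const_eq_pure] at h
  exact h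

lemma agree_of_mem_support_pairHistory (π : Policy S) (T : ℕ) :
    ∀ x ∈ (d.pairHistory π T).support, x.2.Agree := by
  intro x hx
  have h : (x.1.1, x.2) ∈ ((d.pairHistory π T).map fun x => (x.1.1, x.2)).support :=
    (PMF.mem_support_map_iff _ _ _).2 ⟨x, hx, rfl⟩
  rw [pairHistory_map_left] at h
  obtain ⟨y, -, h⟩ := (PMF.mem_support_bind_iff _ _ _).1 h
  obtain ⟨z, hz, h⟩ := (PMF.mem_support_map_iff _ _ _).1 h
  rw [← (Prod.mk.inj h).2]
  exact (d.agree_of_mem_support_linkState hz).1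

/-- The second system can imitate the first one by a policy that only sees its own history. -/
lemma exists_policy (π : Policy S) : ∃ π' : Policy S, ∀ T,
    (d.pairHistory π T).map (fun x => (x.1.2, x.2.snd)) = P.history π' T := by
  -- Joint law of the second system's own history and its imitating decision. Its conditional law is
  -- the policy sought; the length of the history reveals which `T` applies.
  let Q : ℕ → PMF ((List (Record S) × State S) × Action S) := fun T =>
    (d.pairHistory π T).bind fun x =>
      (π x.1.1 x.2.fst).map fun u => ((x.1.2, x.2.snd), x.2.imitate u)
  choose κ hκ using fun T => exists_disintegration (Q T)
  have hQ : ∀ T, (Q T).map Prod.fst = (d.pairHistory π T).map fun x => (x.1.2, x.2.snd) := by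
    intro T
    simp only [Q, PMF.map_bind, PMF.map_comp, Function.comp_def, map_const_eq_pure]
    rfl
  refine ⟨fun l s => κ l.length (l, s), fun T => ?_⟩
  induction T with
  | zero =>
    simp only [pairHistory, history, PMF.map_comp, Function.comp_def, ← d.startPair_map_snd]
  | succ T ih =>
    -- Given its own history and decision, the second system evolves independently of the first
    -- one's hidden state, so only the law `Q T` matters.
    let step : (List (Record S) × State S) × Action S → PMF (List (Record S) × State S) :=
      fun y => (transmit S y.1.2 y.2).bind fun s => (P.next s).map fun s' =>
        (⟨y.1.2, y.2, s⟩ :: y.1.1, s')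
    have h1 : (d.pairHistory π (T + 1)).map (fun x => (x.1.2, x.2.snd)) = (Q T).bind step := by
      simp only [pairHistory, Q, PMF.bind_map, PMF.map_bind, PMF.map_comp, PMF.bind_bind,
        Function.comp_def, step]
      congr! 4 with x u
      rw [← pairTransmit_map_snd, PMF.bind_map]
      congr 1
      funext z
      simp only [Function.comp_apply, ← d.nextPair_map_snd, PMF.map_comp]
      rfl
    rw [h1, hκ T, hQ, ih, PMF.bind_bind, history]
    refine pmf_bind_congr _ fun x hx => ?_
    rw [PMF.bind_map, length_of_mem_support_history _ _ _ _ hx]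
    rfl

end Degradation

end Prediction

/-! ### Pathwise comparison of deliveries and transmissions -/

/-- Deliveries are counted only at positions `j < τ n`, even those made in the window, which count
on arrival. -/
lemma delivered_eq_of_agree {S : StaticSystem N A} {z z' : PairState S} (hz : z.Agree)
    (hz' : z'.Agree) (u v : Action S) (n : Fin N) :
    Record.delivered ⟨z.snd, v, z'.snd⟩ n = Record.delivered ⟨z.fst, u, z'.fst⟩ n := by
  unfold Record.delivered
  refine Finset.sum_congr rfl fun j _ => Finset.sum_congr rfl fun k _ => ?_
  by_cases hj : (j : ℕ) < S.τ n
  · have h1 := hz n j k hj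
    have h2 := hz' n j k hj
    refine if_congr ?_ rfl rfl
    simp only [PairState.fst, PairState.snd, h1, h2]
  · have h1 : ¬ (j : ℕ) + 1 ≤ S.τ n := by omega
    have h2 : ¬ (j : ℕ) + 1 = S.τ n := by omega
    simp [h1, h2]

lemma energy_imitate_le {S : StaticSystem N A} (z : PairState S) (u : Action S) (s s' : State S)
    (n : Fin N) :
    Record.energy ⟨z.snd, z.imitate u, s⟩ n ≤ Record.energy ⟨z.fst, u, s'⟩ n := by
  unfold Record.energy
  refine Finset.sum_le_sum fun j _ => Finset.sum_le_sum fun k _ => ?_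
  have key : ∀ (p q : Prop) [Decidable p] [Decidable q], (p → q) →
      (if p then 1 else 0 : ℕ) ≤ if q then 1 else 0 := by
    intro p q _ _ h
    by_cases hp : p
    · rw [if_pos hp, if_pos (h hp)]
    · rw [if_neg hp]
      exact Nat.zero_le _
  refine key _ _ fun h => ?_
  simpa [PairState.imitate, PairState.fst] using h.2

lemma pairTransmit_agree {S : StaticSystem N A} {z z' : PairState S} {u : Action S}
    (hz : z.Agree) (h : z' ∈ (pairTransmit S z u).support) : z'.Agree := by
  intro n j k hj
  have h1 : z' n j k ∈ (pairAttempt (S.ζ n) (z n j k) (u n j k)).support :=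
    mem_support_indep.1 (mem_support_indep.1 (mem_support_indep.1 h n) j) k
  have h2 := hz n j k hj
  unfold pairAttempt at h1
  by_cases h3 : (z n j k).1 = some false ∧ u n j k = true
  · rw [if_pos h3] at h1
    obtain ⟨c, -, hc⟩ := (PMF.mem_support_map_iff _ _ _).1 h1
    simp only [← hc, h2.symm.trans h3.1, if_true]
  · rw [if_neg h3] at h1
    rw [(PMF.mem_support_pure_iff _ _).1 h1, h2]

namespace Prediction

variable {S : StaticSystem N A} {P' P : Prediction S}

namespace Degradation

variable (d : Degradation P' P)

lemma totals_of_mem_support_pairHistory (π : Policy S) (T : ℕ) :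
    ∀ x ∈ (d.pairHistory π T).support,
      (∀ n, (x.1.2.map fun r => r.delivered n).sum = (x.1.1.map fun r => r.delivered n).sum) ∧
      (x.1.2.map fun r => ∑ n, r.energy n).sum ≤ (x.1.1.map fun r => ∑ n, r.energy n).sum := by
  induction T with
  | zero =>
    intro x hx
    obtain ⟨s, -, rfl⟩ := (PMF.mem_support_map_iff _ _ _).1 hx
    simp
  | succ T ih =>
    intro x hx
    obtain ⟨y, hy, hx⟩ := (PMF.mem_support_bind_iff _ _ _).1 hx
    obtain ⟨u, -, hx⟩ := (PMF.mem_support_bind_iff _ _ _).1 hx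
    obtain ⟨z, hz, hx⟩ := (PMF.mem_support_bind_iff _ _ _).1 hx
    obtain ⟨z', -, rfl⟩ := (PMF.mem_support_map_iff _ _ _).1 hx
    have hy2 := d.agree_of_mem_support_pairHistory π T y hy
    constructor
    · intro n
      simp only [List.map_cons, List.sum_cons, (ih y hy).1 n]
      rw [delivered_eq_of_agree hy2 (pairTransmit_agree hy2 hz)]
    · simp only [List.map_cons, List.sum_cons]
      exact add_le_add (Finset.sum_le_sum fun n _ => energy_imitate_le _ _ _ _ _) (ih y hy).2

lemma expectedTotal_eq_left (π : Policy S) (f : Record S → ℕ) (T : ℕ) :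
    P'.expectedTotal π f T = ∑' x, d.pairHistory π T x * ((x.1.1.map f).sum : ℕ) := by
  have h := congrArg (fun μ : PMF (List (Record S)) => ∑' l, μ l * (((l.map f).sum : ℕ) : ℝ≥0∞))
    (d.pairHistory_map_fst π T)
  simp only [tsum_map_mul] at h
  exact h.symm

/-- A policy for a degraded prediction can be imitated with the original one, with the same
deliveries and no more transmissions. -/
lemma exists_policy_totals (d : Degradation P' P) (π : Policy S) : ∃ π' : Policy S, ∀ T,
    (∀ n, P.expectedTotal π' (fun r => r.delivered n) T =
      P'.expectedTotal π (fun r => r.delivered n) T) ∧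
    P.expectedTotal π' (fun r => ∑ n, r.energy n) T ≤
      P'.expectedTotal π (fun r => ∑ n, r.energy n) T := by
  obtain ⟨π', hπ'⟩ := d.exists_policy π
  have hright : ∀ (f : Record S → ℕ) (T : ℕ), P.expectedTotal π' f T =
      ∑' x, d.pairHistory π T x * ((x.1.2.map f).sum : ℕ) := by
    intro f T
    rw [expectedTotal, ← hπ', tsum_map_mul]
  refine ⟨π', fun T => ⟨fun n => ?_, ?_⟩⟩
  · rw [hright, d.expectedTotal_eq_left]
    refine tsum_congr fun x => ?_
    by_cases hx : d.pairHistory π T x = 0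
    · simp [hx]
    · rw [(d.totals_of_mem_support_pairHistory π T x ((PMF.mem_support_iff _ _).2 hx)).1 n]
  · rw [hright, d.expectedTotal_eq_left]
    refine ENNReal.tsum_le_tsum fun x => ?_
    by_cases hx : d.pairHistory π T x = 0
    · simp [hx]
    · gcongr
      exact (d.totals_of_mem_support_pairHistory π T x ((PMF.mem_support_iff _ _).2 hx)).2

theorem optimalThroughput_le (d : Degradation P' P) : P'.optimalThroughput ≤ P.optimalThroughput := by
  refine iSup₂_le fun π hπ => ?_
  obtain ⟨π', h⟩ := d.exists_policy_totals π
  have hr : P.resource π' ≤ S.B := by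
    refine le_trans (Filter.limsup_le_limsup (Filter.Eventually.of_forall fun T => ?_)) hπ
    exact ENNReal.div_le_div_right (h T).2 _
  refine le_trans (le_of_eq ?_) (le_iSup₂ (f := fun (π : Policy S) (_ : P.resource π ≤ S.B) =>
    ∑ n, (S.β n : ℝ≥0∞) * P.throughput π n) π' hr)
  simp only [throughput, fun T n => (h T).1 n]

end Degradation

/-! ### The two monotonicity statements as degradations -/

/-- Increasing the false-negative rates degrades a prediction. -/
noncomputable def degradationOfFalseNegative (hp : P.p = P'.p) (hq : P.q ≤ P'.q) :
    Degradation P' P where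
  hit _ := 1
  -- The solution `h` of `h p + (1 - h) q = q'`; it is at most one because `q' < p' = p`.
  miss n := ⟨((P'.q n : ℝ) - P.q n) / (P.p n - P.q n), by
    have h1 : (P.q n : ℝ) < P.p n := P.q_lt_p n
    have h2 : (P'.q n : ℝ) < P.p n := by
      rw [hp]
      exact P'.q_lt_p n
    have h3 : (P.q n : ℝ) ≤ P'.q n := hq n
    exact ⟨div_nonneg (by linarith) (by linarith), (div_le_one (by linarith)).2 (by linarith)⟩⟩
  hit_eq n := by simp [hp]
  miss_eq n := by
    have h1 : (P.p n : ℝ) - P.q n ≠ 0 := sub_ne_zero.2 (ne_of_gt (P.q_lt_p n))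
    simp only
    field_simp
    ring
  sound _ := Or.inl rfl

/-- Without false negatives, decreasing the true-positive rates degrades a prediction. -/
noncomputable def degradationOfTruePositive (hq : P.q = 0) (hq' : P'.q = 0) (hp : P'.p ≤ P.p) :
    Degradation P' P where
  -- With `q = 0` the equation for `hit` reads `h p = p'`.
  hit n := ⟨(P'.p n : ℝ) / P.p n,
    div_nonneg (P'.p n).2.1 (P.p n).2.1, div_le_one_of_le₀ (hp n) (P.p n).2.1⟩
  miss _ := 0
  hit_eq n := by
    have h1 : (P.q n : ℝ) < P.p n := P.q_lt_p n
    have h2 : (P.p n : ℝ) ≠ 0 := ne_of_gt (lt_of_le_of_lt (P.q n).2.1 h1)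
    simp [hq, h2]
  miss_eq n := by simp [hq, hq']
  sound n := Or.inr (congrFun hq n)

end Prediction

end TimelyThroughput

theorem mainTheorem6 {N A : ℕ} (S : TimelyThroughput.StaticSystem N A) :
    (∀ P P' : TimelyThroughput.Prediction S, P.p = P'.p → P.q ≤ P'.q →
      P'.optimalThroughput ≤ P.optimalThroughput) ∧
    (∀ P P' : TimelyThroughput.Prediction S, P.q = 0 → P'.q = 0 → P.p ≤ P'.p →
      P.optimalThroughput ≤ P'.optimalThroughput) :=
  ⟨fun _ _ hp hq =>
      (TimelyThroughput.Prediction.degradationOfFalseNegative hp hq).optimalThroughput_le,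
    fun _ _ hq hq' hp =>
      (TimelyThroughput.Prediction.degradationOfTruePositive hq' hq hp).optimalThroughput_le⟩
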